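/- Let $E=(E^0,E^1,r,s)$ be a row-finite directed graph (every vertex emits finitely many edges) and $K$ a field; let $L_K(E)$ be the Leavitt path algebra of $E$ and, for $X\subseteq E^0$, let $I(X)$ be the two-sided ideal of $L_K(E)$ generated by $X$. A set $H\subseteq E^0$ is hereditary if it contains the end vertex of every path starting in $H$, and saturated if it contains every vertex $v$ with $s^{-1}(v)$ finite and non-empty and $r(s^{-1}(v))\subseteq H$; the hereditary saturated closure $\overline{X}$ is the smallest hereditary saturated set containing $X$. For $H$ hereditary and saturated, $E/H$ is the graph with vertex set $E^0\setminus H$ and edge set $\{e\in E^1: r(e)\notin H\}$, and $\theta\colon L_K(E)/I(H)\to L_K(E/H)$ is the canonical isomorphism, sending $v+I(H)$, $e+I(H)$, $e^*+I(H)$ to $v$, $e$, $e^*$ for every vertex $v$ and edge $e$ of $E/H$. A cycle is a closed path $c=e_1\cdots e_m$ ($m\ge 1$) whose edges have pairwise distinct sources; $c^0$ is the set of these sources, and an exit of $c$ is an edge $f$ with $s(f)=s(e_i)$ and $f\ne e_i$ for some $i$. Let $P_c(E)$ be the set of vertices that lie on a cycle without exits. Put $P_c^{(1)}(E)=\overline{P_c(E)}$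 and, for $n\ge1$, let $P_c^{(n+1)}(E)$ be the hereditary saturated set $H'\subseteq E^0$ with $I(P_c^{(n)}(E))\subseteq I(H')$ and $$\theta\bigl(I(H')/I(P_c^{(n)}(E))\bigr)=I\Bigl(\overline{P_c\bigl(E/P_c^{(n)}(E)\bigr)}\Bigr),$$ where $\theta$ is taken for $H=P_c^{(n)}(E)$; such an $H'$ exists and is unique. Then for every $n\ge 1$, $P_c^{(n+1)}(E)$ is the hereditary saturated closure of $$\mathfrak S_n=\{v\in E^0 : v\in c^0 \text{ for some cycle } c \text{ such that } r(f)\in P_c^{(n)}(E)\text{ for every exit } f \text{ of } c\}.$$ -/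

import Mathlib

universe u v w x

set_option linter.checkUnivs false in
/-- A directed graph: a set `V` of vertices, a set `Edge` of edges (loops and parallel edges are
allowed), and the source and range maps. -/
structure DirGraph where
  V : Type u
  Edge : Type v
  s : Edge → V
  r : Edge → V

namespace DirGraph

/-! ### Graphs -/

section Graphs

variable (E : DirGraph.{u, v})

/-- Every vertex emits finitely many edges. -/
def RowFinite : Prop := ∀ a : E.V, {e : E.Edge | E.s e = a}.Finite

/-- A regular vertex: it emits at least one edge and only finitely many. -/
def IsRegular (a : E.V) : Prop :=
  {e : E.Edge | E.s e = a}.Finite ∧ {e : E.Edge | E.s e = a}.Nonempty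

/-- `E.Reaches a b` is `a ≥ b`: there is a (possibly trivial) path from `a` to `b`. -/
def Reaches : E.V → E.V → Prop :=
  Relation.ReflTransGen fun a b => ∃ e : E.Edge, E.s e = a ∧ E.r e = b

def IsHereditary (H : Set E.V) : Prop := ∀ a ∈ H, ∀ b, E.Reaches a b → b ∈ H

def IsSaturated (H : Set E.V) : Prop :=
  ∀ a, E.IsRegular a → (∀ e, E.s e = a → E.r e ∈ H) → a ∈ H

/-- The set of all hereditary saturated subsets of the set of vertices. -/
structure HSSet where
  carrier : Set E.V
  hereditary : E.IsHereditary carrier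
  saturated : E.IsSaturated carrier

variable {E} in
@[ext] theorem HSSet.ext {H H' : E.HSSet} (h : H.carrier = H'.carrier) : H = H' := by
  cases H; cases H'; cases h; rfl

/-- The hereditary saturated closure: the smallest hereditary saturated set containing `X`. -/
def hsClosure (X : Set E.V) : E.HSSet where
  carrier := {a | ∀ H : E.HSSet, X ⊆ H.carrier → a ∈ H.carrier}
  hereditary a ha b hab H hX := H.hereditary a (ha H hX) b hab
  saturated a ha h H hX := H.saturated a ha fun e he => h e he H hX

/-- The empty set of vertices. -/
def hsEmpty : E.HSSet where
  carrier := ∅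
  hereditary a ha := ha.elim
  saturated a ha h := by
    obtain ⟨e, he⟩ := ha.2
    exact h e he

/-- A cycle `c 0, c 1, …, c k` (of length `k + 1`): the range of each edge is the source of the
next one, the indices being read cyclically, and no vertex is visited twice. -/
structure IsCycle {k : ℕ} (c : Fin (k + 1) → E.Edge) : Prop where
  closed : ∀ i, E.r (c i) = E.s (c (i + 1))
  simple : Function.Injective fun i => E.s (c i)

/-- The edge `f` is an exit of the path with edges `c i`. -/
def IsExit {k : ℕ} (c : Fin (k + 1) → E.Edge) (f : E.Edge) : Prop :=
  ∃ i, E.s f = E.s (c i) ∧ f ≠ c i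

/-- The vertices that lie on a cycle without exits. -/
def Pc : Set E.V :=
  {a | ∃ (k : ℕ) (c : Fin (k + 1) → E.Edge), E.IsCycle c ∧ (∃ i, E.s (c i) = a) ∧
    ∀ f, ¬ E.IsExit c f}

/-- The vertices that lie on a cycle all of whose exits have their range in `X`. -/
def cyclesExitingInto (X : Set E.V) : Set E.V :=
  {a | ∃ (k : ℕ) (c : Fin (k + 1) → E.Edge), E.IsCycle c ∧ (∃ i, E.s (c i) = a) ∧
    ∀ f, E.IsExit c f → E.r f ∈ X}

variable {E} in
/-- The quotient graph `E/H`: the vertices outside `H` and the edges with range outside `H`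
(their sources are outside `H` too, because `H` is hereditary). -/
def quot (H : E.HSSet) : DirGraph.{u, v} where
  V := {a : E.V // a ∉ H.carrier}
  Edge := {e : E.Edge // E.r e ∉ H.carrier}
  s e := ⟨E.s e.1, fun h => e.2 (H.hereditary _ h _ (.single ⟨e.1, rfl, rfl⟩))⟩
  r e := ⟨E.r e.1, e.2⟩

end Graphs

/-! ### Leavitt path algebras -/

section LPA

/-- The generators of the Leavitt path algebra: vertices, edges `e` and ghost edges `e*`. -/
inductive Gen (E : DirGraph.{u, v}) : Type (max u v)
  | vertex : E.V → Gen E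
  | edge : E.Edge → Gen E
  | ghost : E.Edge → Gen E

open Gen

/-- The defining relations of the Leavitt path algebra, for a family `f` of elements of a ring. -/
inductive LeavittRel {E : DirGraph.{u, v}} {A : Type x} [NonUnitalNonAssocSemiring A]
    (f : Gen E → A) : A → A → Prop
  | idem (a : E.V) : LeavittRel f (f (vertex a) * f (vertex a)) (f (vertex a))
  | orth (a b : E.V) : a ≠ b → LeavittRel f (f (vertex a) * f (vertex b)) 0
  | source_edge (e : E.Edge) : LeavittRel f (f (vertex (E.s e)) * f (edge e)) (f (edge e))
  | edge_range (e : E.Edge) : LeavittRel f (f (edge e) * f (vertex (E.r e))) (f (edge e))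
  | range_ghost (e : E.Edge) : LeavittRel f (f (vertex (E.r e)) * f (ghost e)) (f (ghost e))
  | ghost_source (e : E.Edge) : LeavittRel f (f (ghost e) * f (vertex (E.s e))) (f (ghost e))
  | ck1_same (e : E.Edge) : LeavittRel f (f (ghost e) * f (edge e)) (f (vertex (E.r e)))
  | ck1_ne (e e' : E.Edge) : e ≠ e' → LeavittRel f (f (ghost e) * f (edge e')) 0
  | ck2 (a : E.V) (ha : E.IsRegular a) :
      LeavittRel f (∑ e ∈ ha.1.toFinset, f (edge e) * f (ghost e)) (f (vertex a))

theorem LeavittRel.map {E : DirGraph.{u, v}} {A : Type x} {B : Type w}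
    [NonUnitalNonAssocSemiring A] [NonUnitalNonAssocSemiring B] {f : Gen E → A} (φ : A →ₙ+* B)
    {p q : A} (h : LeavittRel f p q) : LeavittRel (fun g => φ (f g)) (φ p) (φ q) := by
  cases h with
  | idem a => rw [map_mul]; exact .idem a
  | orth a b hab => rw [map_mul, map_zero]; exact .orth a b hab
  | source_edge e => rw [map_mul]; exact .source_edge e
  | edge_range e => rw [map_mul]; exact .edge_range e
  | range_ghost e => rw [map_mul]; exact .range_ghost e
  | ghost_source e => rw [map_mul]; exact .ghost_source e
  | ck1_same e => rw [map_mul]; exact .ck1_same e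
  | ck1_ne e e' hne => rw [map_mul, map_zero]; exact .ck1_ne e e' hne
  | ck2 a ha => simp only [map_sum, map_mul]; exact .ck2 a ha

variable (K : Type w) [Field K] (E : DirGraph.{u, v})

/-- The free associative (non-unital) `K`-algebra on the generators. -/
abbrev FreeAlg : Type (max u v w) := MonoidAlgebra K (FreeSemigroup (Gen E))

/-- The generators as elements of the free algebra. -/
noncomputable def FreeAlg.of (g : Gen E) : FreeAlg K E :=
  MonoidAlgebra.single (FreeSemigroup.of g) 1

/-- All scalar multiples of the defining relations. -/
def ScaledRel (p q : FreeAlg K E) : Prop :=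
  ∃ (k : K) (a b : FreeAlg K E), LeavittRel (FreeAlg.of K E) a b ∧ p = k • a ∧ q = k • b

/-- The congruence on the free algebra generated by the defining relations. -/
noncomputable def leavittCon : RingCon (FreeAlg K E) := ringConGen (ScaledRel K E)

theorem leavittCon_smul (k : K) {p q : FreeAlg K E} (h : leavittCon K E p q) :
    leavittCon K E (k • p) (k • q) := by
  change RingConGen.Rel _ _ _ at h
  induction h generalizing k with
  | of p q h =>
    obtain ⟨l, a, b, hab, rfl, rfl⟩ := h
    exact RingConGen.Rel.of _ _ ⟨k * l, a, b, hab, (mul_smul _ _ _).symm, (mul_smul _ _ _).symm⟩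
  | refl p => exact (leavittCon K E).refl _
  | symm _ ih => exact (leavittCon K E).symm (ih k)
  | trans _ _ ih ih' => exact (leavittCon K E).trans (ih k) (ih' k)
  | add _ _ ih ih' => rw [smul_add, smul_add]; exact (leavittCon K E).add (ih k) (ih' k)
  | @mul a b c d _ hcd ih _ =>
    rw [← smul_mul_assoc, ← smul_mul_assoc]
    exact (leavittCon K E).mul (ih k) hcd

/-- The Leavitt path algebra `L_K(E)`, a `K`-algebra that need not have a unit. -/
def LPA : Type (max u v w) := (leavittCon K E).Quotient

namespace LPA

noncomputable instance : NonUnitalRing (LPA K E) :=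
  inferInstanceAs (NonUnitalRing (leavittCon K E).Quotient)

/-- The projection from the free algebra. -/
noncomputable def mk : FreeAlg K E →ₙ+* LPA K E where
  toFun p := (p : (leavittCon K E).Quotient)
  map_mul' _ _ := rfl
  map_zero' := rfl
  map_add' _ _ := rfl

theorem mk_surjective : Function.Surjective (mk K E) := Quotient.mk''_surjective

noncomputable instance : SMul K (LPA K E) where
  smul k := Quotient.map' (fun p => k • p) fun _ _ h => leavittCon_smul K E k h

theorem mk_smul (k : K) (p : FreeAlg K E) : mk K E (k • p) = k • mk K E p := rfl

noncomputable instance : Module K (LPA K E) :=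
  Function.Surjective.module K (mk K E : FreeAlg K E →+ LPA K E) (mk_surjective K E) (mk_smul K E)

instance : IsScalarTower K (LPA K E) (LPA K E) where
  smul_assoc k p q := by
    obtain ⟨p, rfl⟩ := mk_surjective K E p
    obtain ⟨q, rfl⟩ := mk_surjective K E q
    simp only [smul_eq_mul, ← mk_smul, ← map_mul, smul_mul_assoc]

instance : SMulCommClass K (LPA K E) (LPA K E) where
  smul_comm k p q := by
    obtain ⟨p, rfl⟩ := mk_surjective K E p
    obtain ⟨q, rfl⟩ := mk_surjective K E q
    simp only [smul_eq_mul, ← mk_smul, ← map_mul, mul_smul_comm]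

/-- The generators as elements of `L_K(E)`. -/
noncomputable def of (g : Gen E) : LPA K E := mk K E (FreeAlg.of K E g)

theorem rel {p q : LPA K E} (h : LeavittRel (of K E) p q) : p = q := by
  have key : ∀ {a b : FreeAlg K E}, LeavittRel (FreeAlg.of K E) a b → mk K E a = mk K E b :=
    fun {a b} h => Quotient.sound' (RingConGen.Rel.of _ _
      ⟨1, a, b, h, (one_smul _ _).symm, (one_smul _ _).symm⟩)
  cases h with
  | idem a => exact (map_mul _ _ _).symm.trans (key (.idem a))
  | orth a b hab => exact (map_mul _ _ _).symm.trans ((key (.orth a b hab)).trans (map_zero _))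
  | source_edge e => exact (map_mul _ _ _).symm.trans (key (.source_edge e))
  | edge_range e => exact (map_mul _ _ _).symm.trans (key (.edge_range e))
  | range_ghost e => exact (map_mul _ _ _).symm.trans (key (.range_ghost e))
  | ghost_source e => exact (map_mul _ _ _).symm.trans (key (.ghost_source e))
  | ck1_same e => exact (map_mul _ _ _).symm.trans (key (.ck1_same e))
  | ck1_ne e e' h => exact (map_mul _ _ _).symm.trans ((key (.ck1_ne e e' h)).trans (map_zero _))
  | ck2 a ha =>
    refine Eq.trans ?_ (key (.ck2 a ha))
    simp only [map_sum, map_mul]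
    rfl

variable {K E}
variable {A : Type x} [NonUnitalRing A] [Module K A] [IsScalarTower K A A] [SMulCommClass K A A]

/-- The homomorphism from the free algebra given by the images of the generators. -/
noncomputable def freeLift (f : Gen E → A) : FreeAlg K E →ₙₐ[K] A :=
  MonoidAlgebra.liftMagma K (FreeSemigroup.lift f)

theorem freeLift_of (f : Gen E → A) (g : Gen E) :
    freeLift (K := K) f (FreeAlg.of K E g) = f g := by
  simp [freeLift, FreeAlg.of]

/-- The universal property of `L_K(E)`. -/
noncomputable def lift (f : Gen E → A) (hf : ∀ p q, LeavittRel f p q → p = q) :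
    LPA K E →ₙₐ[K] A :=
  have key : ∀ p q, leavittCon K E p q → freeLift (K := K) f p = freeLift f q := by
    intro p q h
    change RingConGen.Rel _ _ _ at h
    induction h with
    | of p q h =>
      obtain ⟨k, a, b, hab, rfl, rfl⟩ := h
      have := hab.map (freeLift (K := K) f : FreeAlg K E →ₙ+* A)
      have hg : (fun g => (freeLift (K := K) f : FreeAlg K E →ₙ+* A) (FreeAlg.of K E g)) = f :=
        funext fun g => freeLift_of f g
      rw [hg] at this
      rw [map_smul, map_smul]
      exact congrArg (k • ·) (hf _ _ this)
    | refl => rfl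
    | symm _ ih => exact ih.symm
    | trans _ _ ih ih' => exact ih.trans ih'
    | add _ _ ih ih' => rw [map_add, map_add, ih, ih']
    | mul _ _ ih ih' => rw [map_mul, map_mul, ih, ih']
  { toFun := fun p => Quotient.liftOn' p (freeLift (K := K) f) key
    map_smul' := by
      intro k p
      obtain ⟨p, rfl⟩ := mk_surjective K E p
      exact map_smul (freeLift (K := K) f) k p
    map_zero' := map_zero (freeLift (K := K) f)
    map_add' := by
      intro p q
      obtain ⟨p, rfl⟩ := mk_surjective K E p
      obtain ⟨q, rfl⟩ := mk_surjective K E q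
      exact map_add (freeLift (K := K) f) p q
    map_mul' := by
      intro p q
      obtain ⟨p, rfl⟩ := mk_surjective K E p
      obtain ⟨q, rfl⟩ := mk_surjective K E q
      exact map_mul (freeLift (K := K) f) p q }

theorem lift_of (f : Gen E → A) (hf : ∀ p q, LeavittRel f p q → p = q) (g : Gen E) :
    lift (K := K) f hf (of K E g) = f g :=
  freeLift_of f g

end LPA

/-- `I(X)`: the two-sided ideal of `L_K(E)` generated by the vertices in `X`. -/
noncomputable def vertexIdeal (X : Set E.V) : TwoSidedIdeal (LPA K E) :=
  TwoSidedIdeal.span ((fun a => LPA.of K E (vertex a)) '' X)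

end LPA

/-! ### The quotient homomorphism -/

section Quotient

open Gen

variable (K : Type w) [Field K] {E : DirGraph.{u, v}} (H : E.HSSet)

open Classical in
/-- The generators of `L_K(E)` that survive in `E/H` go to the generators of the same name, the
others to `0`. -/
noncomputable def quotGen : Gen E → LPA K (quot H)
  | vertex a => if h : a ∈ H.carrier then 0 else LPA.of K (quot H) (vertex ⟨a, h⟩)
  | edge e => if h : E.r e ∈ H.carrier then 0 else LPA.of K (quot H) (edge ⟨e, h⟩)
  | ghost e => if h : E.r e ∈ H.carrier then 0 else LPA.of K (quot H) (ghost ⟨e, h⟩)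

theorem quotGen_rel (p q : LPA K (quot H)) (h : LeavittRel (quotGen K H) p q) : p = q := by
  have hs : ∀ e, E.r e ∉ H.carrier → E.s e ∉ H.carrier := fun e he h =>
    he (H.hereditary _ h _ (.single ⟨e, rfl, rfl⟩))
  cases h with
  | idem a =>
    by_cases ha : a ∈ H.carrier
    · simp [quotGen, ha]
    · simpa [quotGen, ha] using LPA.rel K _ (.idem (E := quot H) ⟨a, ha⟩)
  | orth a b hab =>
    by_cases ha : a ∈ H.carrier
    · simp [quotGen, ha]
    by_cases hb : b ∈ H.carrier
    · simp [quotGen, hb]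
    simpa [quotGen, ha, hb] using LPA.rel K _ (.orth (E := quot H) ⟨a, ha⟩ ⟨b, hb⟩
      fun h => hab (congrArg Subtype.val h))
  | source_edge e =>
    by_cases he : E.r e ∈ H.carrier
    · simp [quotGen, he]
    · simp only [quotGen, he, hs e he, ↓reduceDIte]
      exact LPA.rel K _ (.source_edge (E := quot H) ⟨e, he⟩)
  | edge_range e =>
    by_cases he : E.r e ∈ H.carrier
    · simp [quotGen, he]
    · simp only [quotGen, he, ↓reduceDIte]
      exact LPA.rel K _ (.edge_range (E := quot H) ⟨e, he⟩)
  | range_ghost e =>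
    by_cases he : E.r e ∈ H.carrier
    · simp [quotGen, he]
    · simp only [quotGen, he, ↓reduceDIte]
      exact LPA.rel K _ (.range_ghost (E := quot H) ⟨e, he⟩)
  | ghost_source e =>
    by_cases he : E.r e ∈ H.carrier
    · simp [quotGen, he]
    · simp only [quotGen, he, hs e he, ↓reduceDIte]
      exact LPA.rel K _ (.ghost_source (E := quot H) ⟨e, he⟩)
  | ck1_same e =>
    by_cases he : E.r e ∈ H.carrier
    · simp [quotGen, he]
    · simp only [quotGen, he, ↓reduceDIte]
      exact LPA.rel K _ (.ck1_same (E := quot H) ⟨e, he⟩)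
  | ck1_ne e e' hne =>
    by_cases he : E.r e ∈ H.carrier
    · simp [quotGen, he]
    by_cases he' : E.r e' ∈ H.carrier
    · simp [quotGen, he']
    simpa [quotGen, he, he'] using LPA.rel K _ (.ck1_ne (E := quot H) ⟨e, he⟩ ⟨e', he'⟩
      fun h => hne (congrArg Subtype.val h))
  | ck2 a ha =>
    by_cases haH : a ∈ H.carrier
    · have : ∀ e ∈ ha.1.toFinset, quotGen K H (edge e) * quotGen K H (ghost e) = 0 := by
        intro e he
        have he' : E.r e ∈ H.carrier :=
          H.hereditary _ haH _ (.single ⟨e, by simpa using he, rfl⟩)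
        simp [quotGen, he']
      rw [Finset.sum_eq_zero this]
      simp [quotGen, haH]
    · have hreg : (quot H).IsRegular ⟨a, haH⟩ := by
        constructor
        · refine Set.Finite.of_finite_image (f := Subtype.val) (ha.1.subset ?_)
            Subtype.val_injective.injOn
          rintro _ ⟨e, he, rfl⟩
          exact congrArg Subtype.val he
        · by_contra hempty
          refine haH (H.saturated a ha fun e he => ?_)
          by_contra hr
          exact hempty ⟨⟨e, hr⟩, Subtype.ext he⟩
      have key := LPA.rel K _ (.ck2 (E := quot H) ⟨a, haH⟩ hreg)
      have hv : quotGen K H (vertex a) = LPA.of K (quot H) (vertex ⟨a, haH⟩) := by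
        simp [quotGen, haH]
      rw [hv, ← key]
      symm
      refine Finset.sum_of_injOn (fun e : (quot H).Edge => e.1) Subtype.val_injective.injOn
        ?_ ?_ ?_
      · intro e he
        have : (quot H).s e = ⟨a, haH⟩ := by simpa using he
        have this' : E.s e.1 = a := congrArg Subtype.val this
        simpa using this'
      · intro e he hne
        have hr : E.r e ∈ H.carrier := by
          by_contra hr
          refine hne ⟨⟨e, hr⟩, ?_, rfl⟩
          have he' : (quot H).s ⟨e, hr⟩ = ⟨a, haH⟩ :=
            Subtype.ext (by simpa using he : E.s e = a)
          exact hreg.1.mem_toFinset.2 he'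
        simp [quotGen, hr]
      · intro e _
        have hr : E.r e.1 ∉ H.carrier := e.2
        simp only [quotGen, hr, ↓reduceDIte]
        rfl

/-- The canonical homomorphism `L_K(E) → L_K(E/H)`. -/
noncomputable def quotHom : LPA K E →ₙₐ[K] LPA K (quot H) :=
  LPA.lift (quotGen K H) (quotGen_rel K H)

theorem quotHom_of (g : Gen E) : quotHom K H (LPA.of K E g) = quotGen K H g :=
  LPA.lift_of _ _ g

theorem quotHom_eq_zero {p : LPA K E} (hp : p ∈ vertexIdeal K E H.carrier) :
    quotHom K H p = 0 := by
  have : vertexIdeal K E H.carrier ≤ TwoSidedIdeal.ker (quotHom K H) := by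
    refine TwoSidedIdeal.span_le.2 ?_
    rintro _ ⟨a, ha, rfl⟩
    simp only [SetLike.mem_coe, TwoSidedIdeal.mem_ker, quotHom_of]
    simp [quotGen, ha]
  exact (TwoSidedIdeal.mem_ker _).1 (this hp)

/-- The algebra `L_K(E)/I(H)`. -/
abbrev QuotAlg : Type (max u v w) := (vertexIdeal K E H.carrier).ringCon.Quotient

/-- The projection `L_K(E) → L_K(E)/I(H)`. -/
noncomputable def toQuotAlg : LPA K E →ₙ+* QuotAlg K H where
  toFun p := (p : (vertexIdeal K E H.carrier).ringCon.Quotient)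
  map_mul' _ _ := rfl
  map_zero' := rfl
  map_add' _ _ := rfl

theorem toQuotAlg_surjective : Function.Surjective (toQuotAlg K H) := Quotient.mk''_surjective

/-- The canonical homomorphism `θ : L_K(E)/I(H) → L_K(E/H)`, which sends `a + I(H)` to `a`,
`e + I(H)` to `e` and `e* + I(H)` to `e*` for every vertex `a` and edge `e` of `E/H`. -/
noncomputable def theta : QuotAlg K H →ₙ+* LPA K (quot H) where
  toFun p := Quotient.liftOn' p (quotHom K H) fun p q h => by
    rw [← sub_eq_zero, ← map_sub]
    exact quotHom_eq_zero K H ((TwoSidedIdeal.rel_iff _ p q).1 h)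
  map_zero' := map_zero (quotHom K H)
  map_add' p q := by
    obtain ⟨p, rfl⟩ := toQuotAlg_surjective K H p
    obtain ⟨q, rfl⟩ := toQuotAlg_surjective K H q
    exact map_add (quotHom K H) p q
  map_mul' p q := by
    obtain ⟨p, rfl⟩ := toQuotAlg_surjective K H p
    obtain ⟨q, rfl⟩ := toQuotAlg_surjective K H q
    exact map_mul (quotHom K H) p q

end Quotient

/-! ### The series of a hereditary saturated functor -/

section Series

open Gen

variable (K : Type w) [Field K]

/-- `H'` is the hereditary saturated set that follows `P` in the series of the functor `F`:
`I(P) ⊆ I(H')`, and `θ : L_K(E)/I(P) → L_K(E/P)` maps `I(H')/I(P)` onto `I(F(E/P))`. -/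
def IsSuccessor (F : ∀ G : DirGraph.{u, v}, G.HSSet) {E : DirGraph.{u, v}} (P H' : E.HSSet) :
    Prop :=
  vertexIdeal K E P.carrier ≤ vertexIdeal K E H'.carrier ∧
    theta K P '' (toQuotAlg K P '' (vertexIdeal K E H'.carrier : Set (LPA K E))) =
      (vertexIdeal K (quot P) (F (quot P)).carrier : Set (LPA K (quot P)))

/-- The set of all vertices `a` of `E` such that `θ(a + I(P))` lies in `I(F(E/P))`. It is the
successor of `P` in the sense of `IsSuccessor` (see `isSuccessor_successor`). -/
noncomputable def successor (F : ∀ G : DirGraph.{u, v}, G.HSSet) {E : DirGraph.{u, v}}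
    (P : E.HSSet) : E.HSSet where
  carrier := {a | theta K P (toQuotAlg K P (LPA.of K E (vertex a))) ∈
    vertexIdeal K (quot P) (F (quot P)).carrier}
  hereditary := by
    intro a ha b hab
    induction hab with
    | refl => exact ha
    | tail _ h ih =>
      obtain ⟨e, rfl, rfl⟩ := h
      have h1 : LPA.of K E (vertex (E.r e)) =
          LPA.of K E (ghost e) * (LPA.of K E (vertex (E.s e)) * LPA.of K E (edge e)) := by
        rw [LPA.rel K E (.source_edge e), LPA.rel K E (.ck1_same e)]
      simp only [Set.mem_ofPred_eq] at ih ⊢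
      rw [h1]
      simp only [map_mul]
      exact TwoSidedIdeal.mul_mem_left _ _ _ (TwoSidedIdeal.mul_mem_right _ _ _ ih)
  saturated := by
    intro a ha h
    simp only [Set.mem_ofPred_eq] at h ⊢
    rw [← LPA.rel K E (.ck2 a ha)]
    simp only [map_sum]
    refine sum_mem fun e he => ?_
    have he' : E.s e = a := by simpa using he
    rw [← LPA.rel K E (.edge_range e)]
    simp only [map_mul]
    exact TwoSidedIdeal.mul_mem_right _ _ _ (TwoSidedIdeal.mul_mem_left _ _ _ (h e he'))

theorem quotHom_surjective {E : DirGraph.{u, v}} (P : E.HSSet) :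
    Function.Surjective (quotHom K P) := by
  intro y
  obtain ⟨y, rfl⟩ := LPA.mk_surjective K _ y
  have hgen : ∀ g : Gen (quot P), ∃ z, quotHom K P z = LPA.of K (quot P) g := by
    rintro (⟨a, ha⟩ | ⟨e, he⟩ | ⟨e, he⟩)
    · exact ⟨LPA.of K E (vertex a), by rw [quotHom_of]; simp [quotGen, ha]⟩
    · exact ⟨LPA.of K E (edge e), by rw [quotHom_of]; simp [quotGen, he]⟩
    · exact ⟨LPA.of K E (ghost e), by rw [quotHom_of]; simp [quotGen, he]⟩
  have hsing : ∀ m : FreeSemigroup (Gen (quot P)),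
      ∃ z, quotHom K P z = LPA.mk K (quot P) (MonoidAlgebra.single m 1) := by
    intro m
    induction m using FreeSemigroup.recOnMul with
    | ih1 g => exact hgen g
    | ih2 g m hg hm =>
      obtain ⟨z, hz⟩ := hg
      obtain ⟨z', hz'⟩ := hm
      refine ⟨z * z', ?_⟩
      rw [map_mul, hz, hz', ← map_mul, MonoidAlgebra.single_mul_single, one_mul]
  induction y using MonoidAlgebra.induction_linear with
  | zero => exact ⟨0, by simp⟩
  | add p q hp hq =>
    obtain ⟨z, hz⟩ := hp
    obtain ⟨z', hz'⟩ := hq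
    exact ⟨z + z', by rw [map_add, map_add, hz, hz']⟩
  | single m k =>
    obtain ⟨z, hz⟩ := hsing m
    refine ⟨k • z, ?_⟩
    rw [map_smul, hz, ← LPA.mk_smul]
    congr 1
    simp

theorem mem_successor (F : ∀ G : DirGraph.{u, v}, G.HSSet) {E : DirGraph.{u, v}}
    (P : E.HSSet) (a : E.V) : a ∈ (successor K F P).carrier ↔
      quotHom K P (LPA.of K E (vertex a)) ∈ vertexIdeal K (quot P) (F (quot P)).carrier :=
  Iff.rfl

theorem isSuccessor_successor (F : ∀ G : DirGraph.{u, v}, G.HSSet) {E : DirGraph.{u, v}}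
    (P : E.HSSet) : IsSuccessor K F P (successor K F P) := by
  constructor
  · refine TwoSidedIdeal.span_mono (Set.image_mono fun a ha => ?_)
    have : quotHom K P (LPA.of K E (vertex a)) = 0 := by
      rw [quotHom_of]; simp [quotGen, ha]
    rw [mem_successor, this]
    exact zero_mem _
  · rw [Set.image_image]
    change quotHom K P '' _ = _
    apply Set.Subset.antisymm
    · rintro _ ⟨p, hp, rfl⟩
      have : vertexIdeal K E (successor K F P).carrier ≤
          TwoSidedIdeal.comap (quotHom K P) (vertexIdeal K (quot P) (F (quot P)).carrier) := by
        refine TwoSidedIdeal.span_le.2 ?_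
        rintro _ ⟨a, ha, rfl⟩
        exact (TwoSidedIdeal.mem_comap _).2 ha
      exact (TwoSidedIdeal.mem_comap _).1 (this hp)
    · let J : TwoSidedIdeal (LPA K (quot P)) := TwoSidedIdeal.mk'
        (quotHom K P '' (vertexIdeal K E (successor K F P).carrier : Set (LPA K E)))
        ⟨0, zero_mem _, map_zero _⟩
        (by
          rintro _ _ ⟨p, hp, rfl⟩ ⟨q, hq, rfl⟩
          exact ⟨p + q, add_mem hp hq, map_add _ _ _⟩)
        (by
          rintro _ ⟨p, hp, rfl⟩
          exact ⟨-p, neg_mem hp, map_neg _ _⟩)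
        (by
          rintro z _ ⟨p, hp, rfl⟩
          obtain ⟨z, rfl⟩ := quotHom_surjective K P z
          exact ⟨z * p, TwoSidedIdeal.mul_mem_left _ _ _ hp, map_mul _ _ _⟩)
        (by
          rintro _ z ⟨p, hp, rfl⟩
          obtain ⟨z, rfl⟩ := quotHom_surjective K P z
          exact ⟨p * z, TwoSidedIdeal.mul_mem_right _ _ _ hp, map_mul _ _ _⟩)
      have hJ : vertexIdeal K (quot P) (F (quot P)).carrier ≤ J := by
        refine TwoSidedIdeal.span_le.2 ?_
        rintro _ ⟨⟨a, ha⟩, haF, rfl⟩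
        have h1 : quotHom K P (LPA.of K E (vertex a)) =
            LPA.of K (quot P) (vertex ⟨a, ha⟩) := by
          rw [quotHom_of]; simp [quotGen, ha]
        refine (TwoSidedIdeal.mem_mk' ..).2
          ⟨LPA.of K E (vertex a), TwoSidedIdeal.subset_span ⟨a, ?_, rfl⟩, h1⟩
        rw [mem_successor, h1]
        exact TwoSidedIdeal.subset_span ⟨_, haF, rfl⟩
      intro p hp
      exact (TwoSidedIdeal.mem_mk' ..).1 (hJ hp)

/-- The series `F^{(1)} = F ⊆ F^{(2)} ⊆ ⋯` of a hereditary saturated functor `F`, evaluated at a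
graph `E`. The index starts at `1`; the value at `0` is a dummy. -/
noncomputable def series (F : ∀ G : DirGraph.{u, v}, G.HSSet) (E : DirGraph.{u, v}) :
    ℕ → E.HSSet
  | 0 => E.hsEmpty
  | 1 => F E
  | n + 2 => successor K F (series F E (n + 1))

/-- `P_c^{(n)}(E)`: the series of the hereditary saturated closure of the functor `P_c`. -/
noncomputable def PcSeries (E : DirGraph.{u, v}) (n : ℕ) : E.HSSet :=
  series K (fun G => G.hsClosure G.Pc) E n

end Series

end DirGraph

/-!
The algebraic input is that the vertex ideals see vertices faithfully: for `H` hereditary and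
saturated in a row-finite graph, a vertex lies in `I(H)` only if it lies in `H`
(`DirGraph.vertex_mem_vertexIdeal`). Since a vertex outside `H` survives as a vertex of `E/H`,
this amounts to the vertices being nonzero in `L_K(E/H)`, which is shown by letting a Leavitt path
algebra act on the functions `V × ℕ → K`. Each fibre `{a} × ℕ` over a non-sink `a` is identified
with the disjoint union of the fibres over the ranges of the finitely many edges that `a` emits,
and the edges and ghost edges act by transport along these identifications
(`DirGraph.fibreAction_rel`).

Consequently the successor of `P` is determined by graph theory alone: it consists of `P` and
the vertices of `F(E/P)` (`DirGraph.mem_successor_iff`), and it is the only set with the defining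
property (`DirGraph.IsSuccessor.eq_successor`). Finally, a cycle of `E/P` without exits is the same
thing as a cycle of `E` outside `P` all of whose exits end in `P`, and a cycle that meets `P` lies
in `P`; so the successor is the closure of the cycles exiting into `P`, provided this closure
contains `P`. The latter holds for the terms of the series by induction
(`DirGraph.pcSeries_subset`).
-/

namespace DirGraph

open Gen

/-! ### The action on functions on the fibres -/

section Action

variable {E : DirGraph.{u, v}}

theorem RowFinite.isRegular (hE : E.RowFinite) (e : E.Edge) : E.IsRegular (E.s e) :=
  ⟨hE _, e, rfl⟩

/-- A family of self-maps of `ℕ`, indexed by the edges, that identifies `ℕ`, for each non-sink `a`,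
with the disjoint union of copies of `ℕ`, one for each edge with source `a`. -/
structure IsBranching (j : E.Edge → ℕ → ℕ) : Prop where
  inj : ∀ e e' n n', E.s e = E.s e' → j e n = j e' n' → e = e' ∧ n = n'
  surj : ∀ e₀ m, ∃ e n, E.s e = E.s e₀ ∧ j e n = m

theorem RowFinite.exists_isBranching (hE : E.RowFinite) :
    ∃ j : E.Edge → ℕ → ℕ, IsBranching j := by
  have key : ∀ a : E.V, {e : E.Edge | E.s e = a}.Nonempty →
      Nonempty ({e : E.Edge | E.s e = a} × ℕ ≃ ℕ) := by
    intro a ha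
    have : Finite {e : E.Edge | E.s e = a} := hE a
    have : Nonempty {e : E.Edge | E.s e = a} := ha.to_subtype
    exact nonempty_equiv_of_countable
  have σ (a : E.V) (ha : {e : E.Edge | E.s e = a}.Nonempty) := (key a ha).some
  refine ⟨fun e n => σ (E.s e) ⟨e, rfl⟩ (⟨e, rfl⟩, n), ⟨?_, ?_⟩⟩
  · intro e e' n n' hs h
    have hcongr : ∀ (a : E.V) (ha : E.s e' = a), σ (E.s e') ⟨e', rfl⟩ (⟨e', rfl⟩, n') =
        σ a ⟨e', ha⟩ (⟨e', ha⟩, n') := by rintro _ rfl; rfl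
    have h' := (σ (E.s e) ⟨e, rfl⟩).injective (h.trans (hcongr _ hs.symm))
    exact ⟨congrArg (fun x => x.1.1) h', congrArg Prod.snd h'⟩
  · intro e₀ m
    obtain ⟨⟨⟨e, he⟩, n⟩, hn⟩ := (σ (E.s e₀) ⟨e₀, rfl⟩).surjective m
    have hcongr : ∀ (a : E.V) (ha : E.s e = a), σ (E.s e) ⟨e, rfl⟩ (⟨e, rfl⟩, n) =
        σ a ⟨e, ha⟩ (⟨e, ha⟩, n) := by rintro _ rfl; rfl
    exact ⟨e, n, he, (hcongr _ he).trans hn⟩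

open Classical in
/-- The action of the generators on `E.V × ℕ → K` given by a branching: a vertex `a` restricts
functions to the fibre `{a} × ℕ`, an edge `e` moves the fibre over `r e` into the fibre over `s e`
along `j e`, and `e*` moves it back. -/
noncomputable def fibreAction (K : Type w) [Field K] (j : E.Edge → ℕ → ℕ) :
    Gen E → Module.End K (E.V × ℕ → K)
  | vertex a =>
    { toFun f x := if x.1 = a then f x else 0
      map_add' f g := by ext x; by_cases h : x.1 = a <;> simp [h]
      map_smul' k f := by ext x; by_cases h : x.1 = a <;> simp [h] }
  | edge e =>
    { toFun f := Function.extend (fun n => (E.s e, j e n)) (fun n => f (E.r e, n)) 0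
      map_add' f g := by
        rw [← Function.extend_add, add_zero]; rfl
      map_smul' k f := by
        rw [RingHom.id_apply, ← Function.extend_smul, smul_zero]; rfl }
  | ghost e =>
    { toFun f x := if x.1 = E.r e then f (E.s e, j e x.2) else 0
      map_add' f g := by ext x; by_cases h : x.1 = E.r e <;> simp [h]
      map_smul' k f := by ext x; by_cases h : x.1 = E.r e <;> simp [h] }

variable {K : Type w} [Field K] {j : E.Edge → ℕ → ℕ}

open Classical in
theorem fibreAction_vertex (a : E.V) (f : E.V × ℕ → K) (x : E.V × ℕ) :
    fibreAction K j (vertex a) f x = if x.1 = a then f x else 0 := rfl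

open Classical in
theorem fibreAction_ghost (e : E.Edge) (f : E.V × ℕ → K) (x : E.V × ℕ) :
    fibreAction K j (ghost e) f x = if x.1 = E.r e then f (E.s e, j e x.2) else 0 := rfl

theorem IsBranching.fibreAction_edge (hj : IsBranching j) (e : E.Edge) (f : E.V × ℕ → K) (n : ℕ) :
    fibreAction K j (edge e) f (E.s e, j e n) = f (E.r e, n) := by
  have : Function.Injective fun n => (E.s e, j e n) := fun n n' h =>
    (hj.inj e e n n' rfl (congrArg Prod.snd h)).2
  exact this.extend_apply (fun n => f (E.r e, n)) 0 n

theorem fibreAction_edge_of_notMem (e : E.Edge) (f : E.V × ℕ → K) (x : E.V × ℕ)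
    (hx : ∀ n, (E.s e, j e n) ≠ x) : fibreAction K j (edge e) f x = 0 :=
  Function.extend_apply' (fun n => f (E.r e, n)) (0 : E.V × ℕ → K) x fun ⟨n, hn⟩ => hx n hn

theorem fibreAction_edge_congr (e : E.Edge) {f g : E.V × ℕ → K}
    (h : ∀ n, f (E.r e, n) = g (E.r e, n)) :
    fibreAction K j (edge e) f = fibreAction K j (edge e) g :=
  congrArg (fun φ : ℕ → K => Function.extend (fun n => (E.s e, j e n)) φ (0 : E.V × ℕ → K))
    (funext h)

theorem IsBranching.fibreAction_edge_ne (hj : IsBranching j) {e e' : E.Edge} (hne : e ≠ e')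
    (f : E.V × ℕ → K) (n : ℕ) : fibreAction K j (edge e') f (E.s e, j e n) = 0 := by
  refine fibreAction_edge_of_notMem _ _ _ fun m hm => hne ?_
  exact (hj.inj e e' n m (congrArg Prod.fst hm).symm (congrArg Prod.snd hm).symm).1

/-- The relation `e* e' = 0` for `e ≠ e'` reflects the disjointness of the ranges of `j e` and
`j e'`, and the relation `∑ e e* = a` that these ranges cover the fibre over `a`. -/
theorem fibreAction_rel (hj : IsBranching j) (p q : Module.End K (E.V × ℕ → K))
    (h : LeavittRel (fibreAction K j) p q) : p = q := by
  refine LinearMap.ext fun f => funext fun x => ?_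
  cases h with
  | idem a => by_cases h : x.1 = a <;> simp [fibreAction_vertex, h]
  | orth a b hab =>
    by_cases h : x.1 = a
    · simp [fibreAction_vertex, h, hab]
    · simp [fibreAction_vertex, h]
  | source_edge e =>
    rw [Module.End.mul_apply, fibreAction_vertex]
    split_ifs with h
    · rfl
    · exact (fibreAction_edge_of_notMem _ _ _ fun n hn => h (congrArg Prod.fst hn).symm).symm
  | edge_range e =>
    rw [Module.End.mul_apply]
    exact congrFun (fibreAction_edge_congr e fun n => by simp [fibreAction_vertex]) x
  | range_ghost e =>
    by_cases h : x.1 = E.r e <;> simp [fibreAction_vertex, fibreAction_ghost, h]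
  | ghost_source e =>
    by_cases h : x.1 = E.r e <;> simp [fibreAction_vertex, fibreAction_ghost, h]
  | ck1_same e =>
    rw [Module.End.mul_apply, fibreAction_ghost, fibreAction_vertex, hj.fibreAction_edge]
    split_ifs with h
    · rw [← h]
    · rfl
  | ck1_ne e e' hne =>
    rw [Module.End.mul_apply, fibreAction_ghost, hj.fibreAction_edge_ne hne]
    simp
  | ck2 a ha =>
    rw [LinearMap.sum_apply, Finset.sum_apply, fibreAction_vertex]
    simp only [Module.End.mul_apply]
    obtain ⟨b, m⟩ := x
    split_ifs with h
    · obtain rfl : b = a := h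
      obtain ⟨e₀, rfl⟩ := ha.2
      obtain ⟨e, n, he, rfl⟩ := hj.surj e₀ m
      have hfibre : (E.s e₀, j e n) = (E.s e, j e n) := by rw [he]
      rw [hfibre, Finset.sum_eq_single e]
      · rw [hj.fibreAction_edge, fibreAction_ghost, if_pos rfl]
      · exact fun e' _ hne => hj.fibreAction_edge_ne hne.symm _ n
      · exact fun h => (h (by simpa using he)).elim
    · refine Finset.sum_eq_zero fun e he => fibreAction_edge_of_notMem _ _ _ fun n hn => h ?_
      rw [← (by simpa using he : E.s e = a)]
      exact (congrArg Prod.fst hn).symm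

theorem of_vertex_ne_zero (hE : E.RowFinite) (a : E.V) : LPA.of K E (vertex a) ≠ 0 := by
  obtain ⟨j, hj⟩ := hE.exists_isBranching
  intro h
  have h0 := LPA.lift_of (K := K) (fibreAction K j) (fibreAction_rel hj) (vertex a)
  rw [h, map_zero] at h0
  have h1 := congrFun (LinearMap.congr_fun h0 fun _ => 1) (a, 0)
  simp [fibreAction_vertex] at h1

end Action

/-! ### Vertices in vertex ideals -/

section VertexIdeal

variable {E : DirGraph.{u, v}} (K : Type w) [Field K]

theorem RowFinite.quot (hE : E.RowFinite) (H : E.HSSet) : (quot H).RowFinite := fun a =>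
  .of_finite_image (f := Subtype.val)
    ((hE a.1).subset (by rintro _ ⟨e, rfl, rfl⟩; rfl)) Subtype.val_injective.injOn

theorem quotHom_vertex_of_mem {H : E.HSSet} {a : E.V} (ha : a ∈ H.carrier) :
    quotHom K H (LPA.of K E (vertex a)) = 0 := by
  rw [quotHom_of]; simp [quotGen, ha]

theorem quotHom_vertex {H : E.HSSet} {a : E.V} (ha : a ∉ H.carrier) :
    quotHom K H (LPA.of K E (vertex a)) = LPA.of K (quot H) (vertex ⟨a, ha⟩) := by
  rw [quotHom_of]; simp [quotGen, ha]

/-- A vertex lies in `I(H)` only if it lies in `H`, since otherwise the homomorphism to `L_K(E/H)`,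
which kills `I(H)`, maps it to a vertex of `E/H`. -/
theorem vertex_mem_vertexIdeal (hE : E.RowFinite) (H : E.HSSet) (a : E.V) :
    LPA.of K E (vertex a) ∈ vertexIdeal K E H.carrier ↔ a ∈ H.carrier := by
  refine ⟨fun h => ?_, fun h => TwoSidedIdeal.subset_span ⟨a, h, rfl⟩⟩
  by_contra ha
  have := quotHom_eq_zero K H h
  rw [quotHom_vertex K ha] at this
  exact of_vertex_ne_zero (hE.quot H) _ this

end VertexIdeal

/-! ### Successors -/

section Successor

variable {E : DirGraph.{u, v}} (K : Type w) [Field K]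

/-- The hereditary saturated subset `H \ P` of `E/P`, for `P ⊆ H`. -/
def HSSet.restrict (hE : E.RowFinite) (P H : E.HSSet) (hPH : P.carrier ⊆ H.carrier) :
    (quot P).HSSet where
  carrier := {a | a.1 ∈ H.carrier}
  hereditary a ha b hab := by
    refine H.hereditary a.1 ha b.1 (Relation.ReflTransGen.lift Subtype.val ?_ a b hab)
    rintro _ _ ⟨e, rfl, rfl⟩
    exact ⟨e.1, rfl, rfl⟩
  saturated a ha h := by
    obtain ⟨e, rfl⟩ := ha.2
    refine H.saturated _ (hE.isRegular e.1) fun e' he' => ?_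
    by_cases hr : E.r e' ∈ P.carrier
    · exact hPH hr
    · exact h ⟨e', hr⟩ (Subtype.ext he')

variable {F : ∀ G : DirGraph.{u, v}, G.HSSet} {P : E.HSSet}

theorem mem_successor_iff (hE : E.RowFinite) (a : E.V) :
    a ∈ (successor K F P).carrier ↔ ∀ ha : a ∉ P.carrier, ⟨a, ha⟩ ∈ (F (quot P)).carrier := by
  rw [mem_successor]
  by_cases ha : a ∈ P.carrier
  · simp [quotHom_vertex_of_mem K ha, ha, zero_mem]
  · rw [quotHom_vertex K ha]
    exact (vertex_mem_vertexIdeal K (hE.quot P) _ _).trans ⟨fun h _ => h, fun h => h ha⟩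

theorem subset_successor (hE : E.RowFinite) : P.carrier ⊆ (successor K F P).carrier :=
  fun a ha => (mem_successor_iff K hE a).2 fun h => (h ha).elim

theorem IsSuccessor.eq_successor {K : Type w} [Field K] (hE : E.RowFinite) {H' : E.HSSet}
    (h : IsSuccessor K F P H') : H' = successor K F P := by
  obtain ⟨hle, himage⟩ := h
  rw [Set.image_image] at himage
  change quotHom K P '' _ = _ at himage
  have hPH : P.carrier ⊆ H'.carrier := fun a ha =>
    (vertex_mem_vertexIdeal K hE H' a).1 (hle ((vertex_mem_vertexIdeal K hE P a).2 ha))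
  ext a
  rw [mem_successor]
  constructor
  · intro ha
    exact himage.subset ⟨_, (vertex_mem_vertexIdeal K hE H' a).2 ha, rfl⟩
  · intro ha
    by_cases haP : a ∈ P.carrier
    · exact hPH haP
    obtain ⟨p, hp, hpa⟩ := himage.superset ha
    -- The image of `I(H')` lies in the ideal of `H' \ P`, where the vertices are known.
    have hcomap : vertexIdeal K E H'.carrier ≤
        TwoSidedIdeal.comap (quotHom K P)
          (vertexIdeal K (quot P) (HSSet.restrict hE P H' hPH).carrier) := by
      refine TwoSidedIdeal.span_le.2 ?_
      rintro _ ⟨b, hb, rfl⟩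
      refine (TwoSidedIdeal.mem_comap _).2 ?_
      by_cases hbP : b ∈ P.carrier
      · rw [quotHom_vertex_of_mem K hbP]
        exact zero_mem _
      · rw [quotHom_vertex K hbP]
        exact TwoSidedIdeal.subset_span ⟨_, hb, rfl⟩
    have hmem := (TwoSidedIdeal.mem_comap _).1 (hcomap hp)
    rw [hpa, quotHom_vertex K haP] at hmem
    exact (vertex_mem_vertexIdeal K (hE.quot P) _ _).1 hmem

end Successor

/-! ### Cycles whose exits end in a given set -/

section Cycles

variable {E : DirGraph.{u, v}}

theorem subset_hsClosure (X : Set E.V) : X ⊆ (E.hsClosure X).carrier := fun _ ha _ hX => hX ha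

theorem hsClosure_subset {X : Set E.V} {H : E.HSSet} (h : X ⊆ H.carrier) :
    (E.hsClosure X).carrier ⊆ H.carrier := fun _ ha => ha H h

theorem cyclesExitingInto_mono {X Y : Set E.V} (h : X ⊆ Y) :
    E.cyclesExitingInto X ⊆ E.cyclesExitingInto Y := by
  rintro a ⟨k, c, hc, ha, hexit⟩
  exact ⟨k, c, hc, ha, fun f hf => h (hexit f hf)⟩

theorem Pc_subset_cyclesExitingInto (X : Set E.V) : E.Pc ⊆ E.cyclesExitingInto X := by
  rintro a ⟨k, c, hc, ha, hexit⟩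
  exact ⟨k, c, hc, ha, fun f hf => (hexit f hf).elim⟩

open scoped Fin.NatCast Fin.CommRing in
theorem IsCycle.source_mem {k : ℕ} {c : Fin (k + 1) → E.Edge} (hc : E.IsCycle c) (H : E.HSSet)
    {i : Fin (k + 1)} (hi : E.s (c i) ∈ H.carrier) (i' : Fin (k + 1)) :
    E.s (c i') ∈ H.carrier := by
  have key : ∀ m : ℕ, E.s (c (i + (m : Fin (k + 1)))) ∈ H.carrier := by
    intro m
    induction m with
    | zero => simpa using hi
    | succ m ih =>
      rw [Nat.cast_succ, ← add_assoc, ← hc.closed]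
      exact H.hereditary _ ih _ (.single ⟨_, rfl, rfl⟩)
  simpa using key (i' - i).val

/-- A cycle without exits in `E/P` is a cycle of `E` whose exits end in `P`. -/
theorem val_mem_cyclesExitingInto {P : E.HSSet} {a : (quot P).V} (ha : a ∈ (quot P).Pc) :
    a.1 ∈ E.cyclesExitingInto P.carrier := by
  obtain ⟨k, c, hc, ⟨i, rfl⟩, hexit⟩ := ha
  refine ⟨k, fun i => (c i).1, ⟨fun i => congrArg Subtype.val (hc.closed i), fun i i' h =>
    hc.simple (Subtype.ext h)⟩, ⟨i, rfl⟩, ?_⟩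
  rintro f ⟨i, hs, hne⟩
  by_contra hf
  exact hexit ⟨f, hf⟩ ⟨i, Subtype.ext hs, fun h => hne (congrArg Subtype.val h)⟩

/-- A cycle of `E` whose exits end in `P` and which has a vertex outside `P` is a cycle without
exits in `E/P`. -/
theorem mk_mem_Pc_quot {P : E.HSSet} {a : E.V} (ha : a ∈ E.cyclesExitingInto P.carrier)
    (haP : a ∉ P.carrier) : (⟨a, haP⟩ : (quot P).V) ∈ (quot P).Pc := by
  obtain ⟨k, c, hc, ⟨i, rfl⟩, hexit⟩ := ha
  have hr : ∀ i', E.r (c i') ∉ P.carrier := fun i' h =>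
    haP (hc.source_mem P (hc.closed i' ▸ h) i)
  refine ⟨k, fun i => ⟨c i, hr i⟩, ⟨fun i => Subtype.ext (hc.closed i), fun i i' h =>
    hc.simple (congrArg Subtype.val h)⟩, ⟨i, rfl⟩, ?_⟩
  rintro ⟨f, hf⟩ ⟨i, hs, hne⟩
  exact hf (hexit f ⟨i, congrArg Subtype.val hs, fun h => hne (Subtype.ext h)⟩)

variable (K : Type w) [Field K]

/-- The hypothesis `hP` is needed because the successor of `P` contains `P`. -/
theorem successor_hsClosure_Pc (hE : E.RowFinite) {P : E.HSSet}
    (hP : P.carrier ⊆ (E.hsClosure (E.cyclesExitingInto P.carrier)).carrier) :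
    successor K (fun G => G.hsClosure G.Pc) P = E.hsClosure (E.cyclesExitingInto P.carrier) := by
  refine HSSet.ext (Set.Subset.antisymm (fun a ha => ?_) (hsClosure_subset fun a ha => ?_))
  · by_cases haP : a ∈ P.carrier
    · exact hP haP
    · exact (mem_successor_iff K hE a).1 ha haP (HSSet.restrict hE P _ hP) fun b hb =>
        subset_hsClosure _ (val_mem_cyclesExitingInto hb)
  · exact (mem_successor_iff K hE a).2 fun haP => subset_hsClosure _ (mk_mem_Pc_quot ha haP)

theorem pcSeries_succ_succ (n : ℕ) : E.PcSeries K (n + 2) =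
    successor K (fun G => G.hsClosure G.Pc) (E.PcSeries K (n + 1)) := rfl

theorem pcSeries_subset (hE : E.RowFinite) (n : ℕ) : (E.PcSeries K (n + 1)).carrier ⊆
    (E.hsClosure (E.cyclesExitingInto (E.PcSeries K (n + 1)).carrier)).carrier := by
  induction n with
  | zero => exact hsClosure_subset ((Pc_subset_cyclesExitingInto _).trans (subset_hsClosure _))
  | succ n ih =>
    have hmono : (E.PcSeries K (n + 1)).carrier ⊆ (E.PcSeries K (n + 2)).carrier :=
      subset_successor K hE
    refine Set.Subset.trans (b := (E.hsClosure
      (E.cyclesExitingInto (E.PcSeries K (n + 1)).carrier)).carrier) ?_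
      (hsClosure_subset ((cyclesExitingInto_mono hmono).trans (subset_hsClosure _)))
    rw [pcSeries_succ_succ, successor_hsClosure_Pc K hE ih]

end Cycles

end DirGraph

theorem theorem5p3 {K : Type w} [Field K] (E : DirGraph.{u, v}) (hE : E.RowFinite)
    (n : ℕ) (hn : 1 ≤ n) :
    E.PcSeries K (n + 1) = E.hsClosure (E.cyclesExitingInto (E.PcSeries K n).carrier) ∧
      ∀ H' : E.HSSet,
        DirGraph.IsSuccessor K (fun G => G.hsClosure G.Pc) (E.PcSeries K n) H' ↔
          H' = E.hsClosure (E.cyclesExitingInto (E.PcSeries K n).carrier) := by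
  obtain ⟨n, rfl⟩ := Nat.exists_eq_add_of_le' hn
  rw [DirGraph.pcSeries_succ_succ,
    DirGraph.successor_hsClosure_Pc K hE (DirGraph.pcSeries_subset K hE n)]
  refine ⟨rfl, fun H' => ?_⟩
  rw [← DirGraph.successor_hsClosure_Pc K hE (DirGraph.pcSeries_subset K hE n)]
  refine ⟨fun h => h.eq_successor hE, ?_⟩
  rintro rfl
  exact DirGraph.isSuccessor_successor K _ _
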